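/- Consider the N-graph with vertex set $V=\{0,1,2,3\}$ and edges $\{0,1\},\{1,2\},\{2,3\}$, identified with the vectors $\ell_1=\mathbf e_0+\mathbf e_1$, $\ell_2=\mathbf e_1+\mathbf e_2$, $\ell_3=\mathbf e_2+\mathbf e_3$ of $\mathbb N^4$. For $\mathbf x=(x_0,\dots,x_3)\in\mathbb N^4$ let $\mathbf M_{\mathbf x}\subset\mathbb N^4$ be the set of vectors $\mathbf m$ that count, class by class, the matched items in a matching of the graph which has $x_i$ nodes of type $i$ for each $i\in V$, two nodes being adjacent if and only if their types are adjacent in the N-graph. Let $\mu$ be a probability distribution on $V$, and let $(A_n)_{n\ge 1}$ be i.i.d. with $\mathbb P(A_n=\mathbf e_i)=\mu(i)$. A Markovian decision rule is a map $u:\mathbb N^4\to\mathbb N^4$, deterministic or random, with $\mathbf x-u(\mathbf x)\in\mathbf M_{\mathbf x}$ for all $\mathbf x$. An admissible policy $\pi=(u_n)_{n\ge 0}$ is a sequence of such rules, with $u_n$ independent of the past states and of the next arrival; it is stationary if $u_n=u$ does not depend on $n$. Under $\pi$ and from the initial state $\mathbf x$, the buffer evolves according to $X_0=\mathbf x$ and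 $X_{n+1}=u_n(X_n)+A_{n+1}$, where $A_{n+1}$ is independent of $X_0,\dots,X_n$ and of the decision $u_n(X_n)$. Let $\gamma\in(0,1)$, let $c_0,c_1,c_2,c_3\ge 0$ satisfy $c_2\le c_0$ and $c_1\le c_3$, and let $c(\mathbf x)=c_0x_0+c_1x_1+c_2x_2+c_3x_3$. The discounted cost of an admissible policy $\pi$ from $\mathbf x$ is $$v_\gamma^\pi(\mathbf x)=\sum_{n=0}^{\infty}\gamma^n\,\mathbb E_{\mathbf x}^\pi[c(X_n)].$$ Then there exist thresholds $(t_i)_{i\in\mathbb Z}$ in $\mathbb N\cup\{+\infty\}$ such that the deterministic map $$u(\mathbf x)=\mathbf x-(x_0\wedge x_1)\,\ell_1-(x_2\wedge x_3)\,\ell_3-k_{t_{i(\mathbf x)}}(\mathbf x)\,\ell_2,$$ where $$k_t(\mathbf x)=\big((x_1-x_0)\wedge(x_2-x_3)-t\big)^+,\qquad i(\mathbf x)=(x_1-x_0)-(x_2-x_3),$$ is a decision rule, and the stationary policy $\pi^*$ that uses $u$ at every time is optimal: $v_\gamma^{\pi^*}(\mathbf x)\le v_\gamma^\pi(\mathbf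 x)$ for every $\mathbf x\in\mathbb N^4$ and every admissible policy $\pi$. -/

import Mathlib

open scoped NNReal ENNReal

namespace NMatching

/-- The state of the buffer: `x i` is the number of stored items of class `i`. -/
abbrev State : Type := Fin 4 → ℕ

/-- The N-graph on the classes `0, 1, 2, 3`, with edges `{0,1}`, `{1,2}`, `{2,3}`. -/
def nGraph : SimpleGraph (Fin 4) :=
  SimpleGraph.fromEdgeSet {s(0, 1), s(1, 2), s(2, 3)}

/-- The `i`-th vector of the canonical basis: a single item of class `i`. -/
def item (i : Fin 4) : State := Pi.single i 1

/-- The vector identified with the edge `ℓ₁ = {0,1}`. -/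
def ell1 : State := item 0 + item 1

/-- The vector identified with the edge `ℓ₂ = {1,2}`. -/
def ell2 : State := item 1 + item 2

/-- The vector identified with the edge `ℓ₃ = {2,3}`. -/
def ell3 : State := item 2 + item 3

/-- The block model graph of a state `x`: there are `x i` nodes of type `i`, and two nodes are
adjacent if and only if their types are adjacent in the N-graph. -/
def blockGraph (x : State) : SimpleGraph (Σ i : Fin 4, Fin (x i)) :=
  nGraph.comap Sigma.fst

/-- The possible matches from the state `x`: the matchings of the block model graph of `x`, each
one identified with the vector that counts the matched items of each class. -/
def matchings (x : State) : Set State :=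
  {m | ∃ M : (blockGraph x).Subgraph, M.IsMatching ∧ ∀ i, m i = {v ∈ M.verts | v.1 = i}.ncard}

/-- A (possibly randomized) Markovian rule, given by the law of the state that is left after the
matches decided in a given state. A deterministic rule is one whose laws are Dirac masses. -/
abbrev Rule : Type := State → PMF State

/-- A rule is a decision rule if, from each state `x`, it almost surely executes
a matching of `x`. -/
def IsDecisionRule (u : Rule) : Prop :=
  ∀ x, ∀ y ∈ (u x).support, ∃ m ∈ matchings x, y + m = x

/-- A policy: the rule used at each time. -/
abbrev Policy : Type := ℕ → Rule

/-- A policy is admissible if it is structured by decision rules. -/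
def IsAdmissible (π : Policy) : Prop := ∀ n, IsDecisionRule (π n)

/-- The law of `X n` under the policy `π` from the initial state `x`: `X 0 = x` and
`X (n + 1) = (π n) (X n) + A (n + 1)`, where the arrival `A (n + 1)` is an item whose class has
law `μ`, independent of the past and of the decision. -/
noncomputable def stateLaw (μ : PMF (Fin 4)) (π : Policy) (x : State) : ℕ → PMF State
  | 0 => PMF.pure x
  | n + 1 => (stateLaw μ π x n).bind fun y => (π n y).bind fun z => μ.map fun i => z + item i

/-- The linear cost `c₀ x₀ + c₁ x₁ + c₂ x₂ + c₃ x₃`. -/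
def linearCost (c : Fin 4 → ℝ≥0) (x : State) : ℝ≥0 := ∑ i, c i * (x i : ℝ≥0)

/-- The condition on the (nonnegative) coefficients of an admissible linear cost. -/
def IsAdmissibleCost (c : Fin 4 → ℝ≥0) : Prop := c 2 ≤ c 0 ∧ c 1 ≤ c 3

/-- The expectation of the cost of `X n` under the policy `π` from the initial state `x`. -/
noncomputable def expectedCost (μ : PMF (Fin 4)) (c : Fin 4 → ℝ≥0) (π : Policy) (x : State)
    (n : ℕ) : ℝ≥0∞ :=
  ∑' y, stateLaw μ π x n y * (linearCost c y : ℝ≥0∞)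

/-- The discounted cost of the policy `π` from the initial state `x`: the sum over `n` of
`γ ^ n` times the expected cost of `X n`. -/
noncomputable def discountedCost (μ : PMF (Fin 4)) (γ : ℝ≥0) (c : Fin 4 → ℝ≥0) (π : Policy)
    (x : State) : ℝ≥0∞ :=
  ∑' n : ℕ, (γ : ℝ≥0∞) ^ n * expectedCost μ c π x n

/-- An admissible policy is optimal if it minimizes the discounted cost among all admissible
policies, from every initial state. -/
def IsOptimal (μ : PMF (Fin 4)) (γ : ℝ≥0) (c : Fin 4 → ℝ≥0) (π : Policy) : Prop :=
  IsAdmissible π ∧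
    ∀ π', IsAdmissible π' → ∀ x, discountedCost μ γ c π x ≤ discountedCost μ γ c π' x

/-- The index `i(x) = (x₁ - x₀) - (x₂ - x₃)`. -/
def diffIndex (x : State) : ℤ := ((x 1 : ℤ) - x 0) - ((x 2 : ℤ) - x 3)

/-- The number `((x₁ - x₀) ∧ (x₂ - x₃) - t)⁺` of `ℓ₂` matches, for the threshold `t`
in `ℕ ∪ {+∞}`. -/
noncomputable def numMatch (t : ℕ∞) (x : State) : ℕ :=
  open Classical in
  if t = ⊤ then 0
  else (min ((x 1 : ℤ) - x 0) ((x 2 : ℤ) - x 3) - (t.toNat : ℤ)).toNat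

/-- The matches executed by the threshold rule of thresholds `t`: all possible `ℓ₁` and `ℓ₃`
edges, and then the `ℓ₂` edges above the threshold. -/
noncomputable def thresholdMatch (t : ℤ → ℕ∞) (x : State) : State :=
  min (x 0) (x 1) • ell1 + min (x 2) (x 3) • ell3 + numMatch (t (diffIndex x)) x • ell2

/-- The (deterministic) threshold type decision rules, with priority for `ℓ₁` and `ℓ₃`. -/
def IsThresholdRule (u : Rule) : Prop :=
  ∃ t : ℤ → ℕ∞, ∀ x, u x = PMF.pure (x - thresholdMatch t x)

end NMatching

/-! Put p = x₁ - x₀ and q = x₂ - x₃. Matches ℓ₁ and ℓ₃ leave (p, q) unchanged, a match ℓ₂ lowers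
both by one, and an arrival shifts them independently of the rest of the state. Among buffers with
given differences the cheapest has no ℓ₁ or ℓ₃ edge left, whence the priority of these edges; only
the number of ℓ₂ matches remains to be chosen.

Relax the problem: from (p, q) any number of ℓ₂ matches is allowed, feasible or not. The dynamic
programming operator is then an infimum over a whole half-diagonal, and it preserves convexity and
monotonicity along diagonals (`DiagonalRegular.bellman`). Nothing is gained by the relaxation,
because c₂ ≤ c₀ and c₁ ≤ c₃ make infeasible matches useless (`DiagonalRegular.postValue_le_of_le`).
Value iteration increases to a finite limit of the same shape, and a function convex on a diagonal
and nonincreasing at negative levels is minimized over j ≤ m at min(m, t) for a fixed t ≥ 0,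
possibly infinite: this is the threshold (`exists_threshold`).

Verification returns to the original problem: the finite horizon values bound every admissible
policy from below (`le_discountedCost`), and their limit bounds the threshold policy from above
(`discountedCost_le`). -/

namespace NMatching

/-! ### The relaxed problem on the differences -/

/-- The change of `x 1 - x 0` due to the arrival of an item. -/
def arrivalFst : Fin 4 → ℤ := ![-1, 1, 0, 0]

/-- The change of `x 2 - x 3` due to the arrival of an item. -/
def arrivalSnd : Fin 4 → ℤ := ![0, 0, 1, -1]

/-- The cost of the buffer without `ℓ₁` and `ℓ₃` edges for which `x 1 - x 0 = p` and
`x 2 - x 3 = q`. -/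
def reducedCost (c : Fin 4 → ℝ≥0) (p q : ℤ) : ℝ≥0 :=
  c 0 * ((-p).toNat : ℝ≥0) + c 1 * (p.toNat : ℝ≥0) + c 2 * (q.toNat : ℝ≥0) +
    c 3 * ((-q).toNat : ℝ≥0)

/-- The expected cost of the arriving item. -/
noncomputable def arrivalCost (μ : PMF (Fin 4)) (c : Fin 4 → ℝ≥0) : ℝ≥0∞ := ∑ i, μ i * (c i : ℝ≥0∞)

/-- The cost of leaving the differences `(p, q)` after a decision, for the continuation
value `V`. -/
noncomputable def postValue (μ : PMF (Fin 4)) (γ : ℝ≥0) (c : Fin 4 → ℝ≥0) (V : ℤ → ℤ → ℝ≥0∞)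
    (p q : ℤ) : ℝ≥0∞ :=
  (reducedCost c p q : ℝ≥0∞) + arrivalCost μ c +
    (γ : ℝ≥0∞) * ∑ i, μ i * V (p + arrivalFst i) (q + arrivalSnd i)

/-- The dynamic programming operator, in which any number of `ℓ₂` matches is allowed. -/
noncomputable def bellman (μ : PMF (Fin 4)) (γ : ℝ≥0) (c : Fin 4 → ℝ≥0) (V : ℤ → ℤ → ℝ≥0∞)
    (p q : ℤ) : ℝ≥0∞ :=
  ⨅ k : ℕ, postValue μ γ c V (p - k) (q - k)

/-- Finite functions that are convex and nonincreasing in the diagonal direction. -/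
structure DiagonalRegular (V : ℤ → ℤ → ℝ≥0∞) : Prop where
  ne_top : ∀ p q, V p q ≠ ⊤
  convex : ∀ p q, 2 * V p q ≤ V (p + 1) (q + 1) + V (p - 1) (q - 1)
  anti : ∀ p q, V (p + 1) (q + 1) ≤ V p q

variable {μ : PMF (Fin 4)} {γ : ℝ≥0} {c : Fin 4 → ℝ≥0} {V W : ℤ → ℤ → ℝ≥0∞}

lemma reducedCost_convex (c : Fin 4 → ℝ≥0) (p q : ℤ) :
    2 * reducedCost c p q ≤ reducedCost c (p + 1) (q + 1) + reducedCost c (p - 1) (q - 1) := by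
  have key (r : ℤ) : 2 * (r.toNat : ℝ≥0) ≤ ((r + 1).toNat : ℝ≥0) + ((r - 1).toNat : ℝ≥0) := by
    have h : 2 * r.toNat ≤ (r + 1).toNat + (r - 1).toNat := by omega
    exact_mod_cast h
  have key' (r : ℤ) : 2 * ((-r).toNat : ℝ≥0) ≤
      ((-(r + 1)).toNat : ℝ≥0) + ((-(r - 1)).toNat : ℝ≥0) := by
    have h : 2 * (-r).toNat ≤ (-(r + 1)).toNat + (-(r - 1)).toNat := by omega
    exact_mod_cast h
  unfold reducedCost
  calc _ = c 0 * (2 * ((-p).toNat : ℝ≥0)) + c 1 * (2 * (p.toNat : ℝ≥0)) +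
        c 2 * (2 * (q.toNat : ℝ≥0)) + c 3 * (2 * ((-q).toNat : ℝ≥0)) := by ring
    _ ≤ c 0 * (((-(p + 1)).toNat : ℝ≥0) + ((-(p - 1)).toNat : ℝ≥0)) +
        c 1 * (((p + 1).toNat : ℝ≥0) + ((p - 1).toNat : ℝ≥0)) +
        c 2 * (((q + 1).toNat : ℝ≥0) + ((q - 1).toNat : ℝ≥0)) +
        c 3 * (((-(q + 1)).toNat : ℝ≥0) + ((-(q - 1)).toNat : ℝ≥0)) := by
      gcongr
      · exact key' p
      · exact key p
      · exact key q
      · exact key' q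
    _ = _ := by ring

/-- If p < 0, the step removes one item of class 0 and either adds one of class 2 or removes one of
class 3, so the cost changes by at most c₂ - c₀ ≤ 0. The case q < 0 is symmetric, with c₁ - c₃. -/
lemma reducedCost_anti (hc : IsAdmissibleCost c) {p q : ℤ} (h : p < 0 ∨ q < 0) :
    reducedCost c (p + 1) (q + 1) ≤ reducedCost c p q := by
  unfold reducedCost
  obtain ⟨h20, h13⟩ := hc
  rcases h with h | h
  · have e0 : (-p).toNat = (-(p + 1)).toNat + 1 := by omega
    have e1 : (p + 1).toNat = p.toNat := by omega
    have e2 : (q + 1).toNat ≤ q.toNat + 1 := by omega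
    have e3 : (-(q + 1)).toNat ≤ (-q).toNat := by omega
    rw [e0, e1]
    calc _ ≤ c 0 * ((-(p + 1)).toNat : ℝ≥0) + c 1 * (p.toNat : ℝ≥0) +
          c 2 * ((q.toNat + 1 : ℕ) : ℝ≥0) + c 3 * ((-q).toNat : ℝ≥0) := by gcongr
      _ = c 0 * ((-(p + 1)).toNat : ℝ≥0) + c 1 * (p.toNat : ℝ≥0) +
          c 2 * (q.toNat : ℝ≥0) + c 3 * ((-q).toNat : ℝ≥0) + c 2 := by push_cast; ring
      _ ≤ c 0 * ((-(p + 1)).toNat : ℝ≥0) + c 1 * (p.toNat : ℝ≥0) +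
          c 2 * (q.toNat : ℝ≥0) + c 3 * ((-q).toNat : ℝ≥0) + c 0 := by gcongr
      _ = _ := by push_cast; ring
  · have e0 : (-q).toNat = (-(q + 1)).toNat + 1 := by omega
    have e1 : (q + 1).toNat = q.toNat := by omega
    have e2 : (p + 1).toNat ≤ p.toNat + 1 := by omega
    have e3 : (-(p + 1)).toNat ≤ (-p).toNat := by omega
    rw [e0, e1]
    calc _ ≤ c 0 * ((-p).toNat : ℝ≥0) + c 1 * ((p.toNat + 1 : ℕ) : ℝ≥0) +
          c 2 * (q.toNat : ℝ≥0) + c 3 * ((-(q + 1)).toNat : ℝ≥0) := by gcongr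
      _ = c 0 * ((-p).toNat : ℝ≥0) + c 1 * (p.toNat : ℝ≥0) +
          c 2 * (q.toNat : ℝ≥0) + c 3 * ((-(q + 1)).toNat : ℝ≥0) + c 1 := by push_cast; ring
      _ ≤ c 0 * ((-p).toNat : ℝ≥0) + c 1 * (p.toNat : ℝ≥0) +
          c 2 * (q.toNat : ℝ≥0) + c 3 * ((-(q + 1)).toNat : ℝ≥0) + c 3 := by gcongr
      _ = _ := by push_cast; ring

lemma arrivalCost_ne_top (μ : PMF (Fin 4)) (c : Fin 4 → ℝ≥0) : arrivalCost μ c ≠ ⊤ :=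
  ENNReal.sum_ne_top.2 fun i _ => ENNReal.mul_ne_top (μ.apply_ne_top i) ENNReal.coe_ne_top

lemma postValue_mono (h : ∀ p q, V p q ≤ W p q) (p q : ℤ) :
    postValue μ γ c V p q ≤ postValue μ γ c W p q := by
  unfold postValue
  gcongr
  exact h _ _

lemma bellman_mono (h : ∀ p q, V p q ≤ W p q) (p q : ℤ) :
    bellman μ γ c V p q ≤ bellman μ γ c W p q :=
  iInf_mono fun _ => postValue_mono h _ _

lemma DiagonalRegular.postValue_ne_top (hV : DiagonalRegular V) (p q : ℤ) :
    postValue μ γ c V p q ≠ ⊤ :=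
  ENNReal.add_ne_top.2 ⟨ENNReal.add_ne_top.2 ⟨ENNReal.coe_ne_top, arrivalCost_ne_top μ c⟩,
    ENNReal.mul_ne_top ENNReal.coe_ne_top <| ENNReal.sum_ne_top.2 fun i _ =>
      ENNReal.mul_ne_top (μ.apply_ne_top i) (hV.ne_top _ _)⟩

lemma DiagonalRegular.postValue_convex (hV : DiagonalRegular V) (p q : ℤ) :
    2 * postValue μ γ c V p q ≤
      postValue μ γ c V (p + 1) (q + 1) + postValue μ γ c V (p - 1) (q - 1) := by
  have h1 : 2 * (reducedCost c p q : ℝ≥0∞) ≤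
      reducedCost c (p + 1) (q + 1) + reducedCost c (p - 1) (q - 1) := by
    exact_mod_cast reducedCost_convex c p q
  have h2 : 2 * ∑ i, μ i * V (p + arrivalFst i) (q + arrivalSnd i) ≤
      ∑ i, μ i * V (p + 1 + arrivalFst i) (q + 1 + arrivalSnd i) +
        ∑ i, μ i * V (p - 1 + arrivalFst i) (q - 1 + arrivalSnd i) := by
    rw [Finset.mul_sum, ← Finset.sum_add_distrib]
    refine Finset.sum_le_sum fun i _ => ?_
    have h := hV.convex (p + arrivalFst i) (q + arrivalSnd i)
    have e (r a : ℤ) : r + 1 + a = r + a + 1 := by ring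
    have e' (r a : ℤ) : r - 1 + a = r + a - 1 := by ring
    rw [← mul_add, mul_left_comm, e, e, e', e']
    exact mul_le_mul_right h (μ i)
  unfold postValue
  calc _ = 2 * (reducedCost c p q : ℝ≥0∞) + 2 * arrivalCost μ c +
        γ * (2 * ∑ i, μ i * V (p + arrivalFst i) (q + arrivalSnd i)) := by ring
    _ ≤ _ := add_le_add (add_le_add h1 le_rfl) (mul_le_mul_right h2 _)
    _ = _ := by ring

lemma DiagonalRegular.postValue_anti (hc : IsAdmissibleCost c) (hV : DiagonalRegular V) {p q : ℤ}
    (h : p < 0 ∨ q < 0) : postValue μ γ c V (p + 1) (q + 1) ≤ postValue μ γ c V p q := by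
  unfold postValue
  gcongr ?_ + _ + _ * ∑ i, _ * ?_ with i
  · exact_mod_cast reducedCost_anti hc h
  · rw [add_right_comm p, add_right_comm q]
    exact hV.anti _ _

/-- Increasing differences of a finite convex function along a diagonal. -/
lemma add_le_add_of_diagonal_convex {L : ℤ → ℤ → ℝ≥0∞} (hfin : ∀ p q, L p q ≠ ⊤)
    (hconv : ∀ p q, 2 * L p q ≤ L (p + 1) (q + 1) + L (p - 1) (q - 1)) (p q : ℤ) (l : ℕ) :
    L p q + L (p - l) (q - l) ≤ L (p + 1) (q + 1) + L (p - 1 - l) (q - 1 - l) := by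
  induction l with
  | zero => simpa [two_mul] using hconv p q
  | succ l ih =>
    have h := add_le_add ih (hconv (p - 1 - l) (q - 1 - l))
    have e (r : ℤ) : r - 1 - l + 1 = r - l := by ring
    have e1 (r : ℤ) : r - ((l + 1 : ℕ) : ℤ) = r - 1 - l := by push_cast; ring
    have e2 (r : ℤ) : r - 1 - ((l + 1 : ℕ) : ℤ) = r - 1 - l - 1 := by push_cast; ring
    rw [e, e] at h
    rw [e1, e1, e2, e2]
    -- The induction hypothesis plus convexity at the lower point share these two terms on both
    -- sides; finiteness allows their cancellation.
    have hf : L (p - l) (q - l) + L (p - 1 - l) (q - 1 - l) ≠ ⊤ :=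
      ENNReal.add_ne_top.2 ⟨hfin _ _, hfin _ _⟩
    refine (ENNReal.add_le_add_iff_left hf).1 ?_
    calc _ = L p q + L (p - l) (q - l) + 2 * L (p - 1 - l) (q - 1 - l) := by ring
      _ ≤ _ := h
      _ = _ := by ring

/-- Monotonicity holds because every point reachable from (p, q) is reachable from (p + 1, q + 1)
with one more match. For convexity, choices made from the two neighbours are replaced by two choices
from (p, q) itself. -/
lemma DiagonalRegular.bellman (hV : DiagonalRegular V) :
    DiagonalRegular (bellman μ γ c V) where
  ne_top p q := ne_top_of_le_ne_top (hV.postValue_ne_top _ _) (iInf_le _ 0)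
  anti p q := by
    refine le_iInf fun k => (iInf_le _ (k + 1)).trans_eq ?_
    congr 1 <;> push_cast <;> ring
  convex p q := by
    have hle (k : ℕ) : NMatching.bellman μ γ c V p q ≤ postValue μ γ c V (p - k) (q - k) :=
      iInf_le _ k
    unfold NMatching.bellman at hle ⊢
    refine ENNReal.le_iInf_add_iInf fun k l => ?_
    rw [two_mul]
    -- Without a match, the upper neighbour stays above (p, q) and convexity of the post-decision
    -- cost is needed. Otherwise both end points are reachable from (p, q), by k and l + 1 matches.
    rcases k with _ | k
    · have h := add_le_add_of_diagonal_convex (L := postValue μ γ c V)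
        hV.postValue_ne_top hV.postValue_convex p q l
      refine le_trans (add_le_add ?_ (hle l)) (le_trans h ?_)
      · simpa using hle 0
      · simp
    · refine add_le_add ((hle k).trans_eq ?_) ((hle (l + 1)).trans_eq ?_) <;>
      congr 1 <;> push_cast <;> ring

/-! ### Value iteration and its limit -/

/-- The optimal cost over `n` steps, as a function of the differences. -/
noncomputable def valueIter (μ : PMF (Fin 4)) (γ : ℝ≥0) (c : Fin 4 → ℝ≥0) : ℕ → ℤ → ℤ → ℝ≥0∞
  | 0 => fun _ _ => 0
  | n + 1 => bellman μ γ c (valueIter μ γ c n)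

/-- The optimal cost over an infinite horizon, as a function of the differences. -/
noncomputable def limitValue (μ : PMF (Fin 4)) (γ : ℝ≥0) (c : Fin 4 → ℝ≥0) (p q : ℤ) : ℝ≥0∞ :=
  ⨆ n, valueIter μ γ c n p q

lemma valueIter_monotone (p q : ℤ) : Monotone fun n => valueIter μ γ c n p q := by
  have h (n : ℕ) : ∀ p q, valueIter μ γ c n p q ≤ valueIter μ γ c (n + 1) p q := by
    induction n with
    | zero => exact fun _ _ => zero_le
    | succ n ih => exact bellman_mono ih
  exact monotone_nat_of_le_succ fun n => h n p q

lemma diagonalRegular_valueIter (n : ℕ) : DiagonalRegular (valueIter μ γ c n) := by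
  induction n with
  | zero => exact ⟨by simp [valueIter], by simp [valueIter], by simp [valueIter]⟩
  | succ n ih => exact ih.bellman

lemma exists_add_mul_eq (hγ1 : γ < 1) (a : ℝ≥0) : ∃ b : ℝ≥0, a + γ * b = b := by
  refine ⟨a / (1 - γ), ?_⟩
  have h : (1 - γ) ≠ 0 := (tsub_pos_of_lt hγ1).ne'
  have h1 : 1 - γ + γ = 1 := tsub_add_cancel_of_le hγ1.le
  calc a + γ * (a / (1 - γ)) = (1 - γ) * (a / (1 - γ)) + γ * (a / (1 - γ)) := by
        rw [mul_div_cancel₀ _ h]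
    _ = (1 - γ + γ) * (a / (1 - γ)) := by ring
    _ = _ := by rw [h1, one_mul]

lemma reducedCost_le (c : Fin 4 → ℝ≥0) (p q : ℤ) :
    reducedCost c p q ≤ (c 0 + c 1 + c 2 + c 3) * ((p.natAbs + q.natAbs : ℕ) : ℝ≥0) := by
  unfold reducedCost
  rw [add_mul, add_mul, add_mul]
  gcongr <;> omega

lemma sum_pmf (μ : PMF (Fin 4)) : ∑ i, μ i = 1 := by
  rw [← tsum_fintype (L := .unconditional _)]; exact μ.tsum_coe

lemma limitValue_ne_top (hγ1 : γ < 1) (p q : ℤ) : limitValue μ γ c p q ≠ ⊤ := by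
  -- The function α + β(|p| + |q|) dominates its image under the operator, already with no match. An
  -- arrival raises |p| + |q| by at most one, so β and α solve the fixed point equations of the
  -- slope and of the constant.
  obtain ⟨β, hβ⟩ := exists_add_mul_eq hγ1 (c 0 + c 1 + c 2 + c 3)
  obtain ⟨α, hα⟩ := exists_add_mul_eq hγ1 ((arrivalCost μ c).toNNReal + γ * β)
  let B (p q : ℤ) : ℝ≥0 := α + β * ((p.natAbs + q.natAbs : ℕ) : ℝ≥0)
  have hB (p q : ℤ) : bellman μ γ c (fun p q => (B p q : ℝ≥0∞)) p q ≤ B p q := by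
    refine (iInf_le _ 0).trans ?_
    have h1 : ∑ i, μ i * (B (p + arrivalFst i) (q + arrivalSnd i) : ℝ≥0∞) ≤
        ((B p q + β : ℝ≥0) : ℝ≥0∞) := by
      calc _ ≤ ∑ i, μ i * ((B p q + β : ℝ≥0) : ℝ≥0∞) := by
            gcongr with i
            have h : (p + arrivalFst i).natAbs + (q + arrivalSnd i).natAbs ≤
                p.natAbs + q.natAbs + 1 := by
              fin_cases i <;> simp [arrivalFst, arrivalSnd] <;> omega
            calc B (p + arrivalFst i) (q + arrivalSnd i)
                ≤ α + β * ((p.natAbs + q.natAbs + 1 : ℕ) : ℝ≥0) := by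
                  simp only [B]; gcongr
              _ = _ := by simp only [B]; push_cast; ring
        _ = _ := by rw [← Finset.sum_mul, sum_pmf, one_mul]
    simp only [Nat.cast_zero, sub_zero, postValue]
    rw [← ENNReal.coe_toNNReal (arrivalCost_ne_top μ c)]
    refine (add_le_add le_rfl (mul_le_mul_right h1 _)).trans ?_
    norm_cast
    calc reducedCost c p q + (arrivalCost μ c).toNNReal + γ * (B p q + β)
        ≤ (c 0 + c 1 + c 2 + c 3) * ((p.natAbs + q.natAbs : ℕ) : ℝ≥0) +
          (arrivalCost μ c).toNNReal + γ * (B p q + β) := by gcongr; exact reducedCost_le c p q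
      _ = ((arrivalCost μ c).toNNReal + γ * β + γ * α) +
          (c 0 + c 1 + c 2 + c 3 + γ * β) * ((p.natAbs + q.natAbs : ℕ) : ℝ≥0) := by
        simp only [B]; ring
      _ = B p q := by rw [hα, hβ]
  have h (n : ℕ) : ∀ p q, valueIter μ γ c n p q ≤ B p q := by
    induction n with
    | zero => exact fun _ _ => zero_le
    | succ n ih => exact fun p q => (bellman_mono ih p q).trans (hB p q)
  exact ne_top_of_le_ne_top ENNReal.coe_ne_top (iSup_le fun n => h n p q)

lemma diagonalRegular_limitValue (hγ1 : γ < 1) : DiagonalRegular (limitValue μ γ c) where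
  ne_top := limitValue_ne_top hγ1
  anti p q := iSup_mono fun n => (diagonalRegular_valueIter n).anti p q
  convex p q := by
    unfold limitValue
    rw [ENNReal.mul_iSup]
    exact iSup_le fun n => ((diagonalRegular_valueIter n).convex p q).trans
      (add_le_add (le_iSup (fun n => valueIter μ γ c n (p + 1) (q + 1)) n)
        (le_iSup (fun n => valueIter μ γ c n (p - 1) (q - 1)) n))

lemma postValue_limitValue (p q : ℤ) :
    postValue μ γ c (limitValue μ γ c) p q = ⨆ n, postValue μ γ c (valueIter μ γ c n) p q := by
  unfold postValue limitValue
  simp only [ENNReal.mul_iSup]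
  rw [ENNReal.finsetSum_iSup_of_monotone
    (f := fun i n => μ i * valueIter μ γ c n (p + arrivalFst i) (q + arrivalSnd i))
    (fun i m n h => mul_le_mul_right (valueIter_monotone _ _ h) _), ENNReal.mul_iSup,
    ENNReal.add_iSup]

/-- Executing more than the feasible number of `ℓ₂` matches does not pay off. -/
lemma DiagonalRegular.postValue_le_of_le (hc : IsAdmissibleCost c) (hV : DiagonalRegular V)
    (p q : ℤ) {k : ℕ} (hk : (min p q).toNat ≤ k) :
    postValue μ γ c V (p - (min p q).toNat) (q - (min p q).toNat) ≤
      postValue μ γ c V (p - k) (q - k) := by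
  induction k, hk using Nat.le_induction with
  | base => rfl
  | succ k hk ih =>
    refine ih.trans ?_
    have h := hV.postValue_anti (μ := μ) (γ := γ) hc
      (p := p - (k + 1 : ℕ)) (q := q - (k + 1 : ℕ)) (by omega)
    have e (r : ℤ) : r - ((k + 1 : ℕ) : ℤ) + 1 = r - k := by push_cast; ring
    rwa [e, e] at h

/-- With finitely many choices, the infimum commutes with the increasing limit of value iteration.
-/
lemma DiagonalRegular.bellman_eq (hc : IsAdmissibleCost c) (hV : DiagonalRegular V) (p q : ℤ) :
    NMatching.bellman μ γ c V p q =
      ⨅ k : Fin ((min p q).toNat + 1), postValue μ γ c V (p - (k : ℕ)) (q - (k : ℕ)) := by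
  refine le_antisymm (le_iInf fun k => iInf_le _ (k : ℕ)) (le_iInf fun k => ?_)
  rcases le_or_gt k (min p q).toNat with h | h
  · exact iInf_le (fun k : Fin ((min p q).toNat + 1) =>
      postValue μ γ c V (p - (k : ℕ)) (q - (k : ℕ))) ⟨k, by omega⟩
  · exact (iInf_le (fun k : Fin ((min p q).toNat + 1) =>
      postValue μ γ c V (p - (k : ℕ)) (q - (k : ℕ))) (Fin.last _)).trans
      (hV.postValue_le_of_le hc p q h.le)

lemma bellman_limitValue_le (hγ1 : γ < 1) (hc : IsAdmissibleCost c) (p q : ℤ) :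
    bellman μ γ c (limitValue μ γ c) p q ≤ limitValue μ γ c p q := by
  rw [(diagonalRegular_limitValue hγ1).bellman_eq hc]
  simp only [postValue_limitValue]
  rw [← iSup_iInf_of_monotone (f := fun (k : Fin ((min p q).toNat + 1)) n =>
    postValue μ γ c (valueIter μ γ c n) (p - (k : ℕ)) (q - (k : ℕ))) fun k m n h =>
    postValue_mono (fun p q => valueIter_monotone p q h) _ _]
  refine iSup_le fun n => ?_
  rw [← (diagonalRegular_valueIter n).bellman_eq hc]
  exact le_iSup (fun n => valueIter μ γ c n p q) (n + 1)

/-! ### Thresholds from diagonal convexity -/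

/-- The number `(m - t)⁺` of matches for the threshold `t`. -/
noncomputable def excess (t : ℕ∞) (m : ℤ) : ℕ :=
  open Classical in if t = ⊤ then 0 else (m - (t.toNat : ℤ)).toNat

/-- The threshold is the first natural level at which φ stops decreasing strictly. By convexity φ is
nondecreasing from there on; below it, φ is nonincreasing. If no such level exists, φ is
nonincreasing everywhere and it is best never to match. -/
lemma exists_threshold {φ : ℤ → ℝ≥0∞} (hfin : ∀ j, φ j ≠ ⊤)
    (hconv : ∀ j, 2 * φ j ≤ φ (j + 1) + φ (j - 1)) (hanti : ∀ j < 0, φ (j + 1) ≤ φ j) :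
    ∃ t : ℕ∞, ∀ m j, j ≤ m → φ (m - excess t m) ≤ φ j := by
  classical
  by_cases h : ∃ t : ℕ, φ t ≤ φ (t + 1)
  · refine ⟨(Nat.find h : ℕ), fun m j hj => ?_⟩
    set t := Nat.find h
    have ht : φ t ≤ φ (t + 1) := Nat.find_spec h
    have hlt (j : ℤ) (hj : j < t) : φ (j + 1) ≤ φ j := by
      rcases lt_or_ge j 0 with h0 | h0
      · exact hanti j h0
      · lift j to ℕ using h0
        exact (not_le.1 (Nat.find_min h (by exact_mod_cast hj))).le
    have hge (j : ℤ) (hj : (t : ℤ) ≤ j) : φ j ≤ φ (j + 1) := by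
      induction j, hj using Int.leInduction with
      | base => exact ht
      | succ j hj ih =>
        have h := hconv (j + 1)
        rw [add_sub_cancel_right, two_mul] at h
        exact (ENNReal.add_le_add_iff_right (hfin (j + 1))).1 (h.trans (by gcongr))
    have down (i : ℤ) (hi : i ≤ t) (j : ℤ) (hj : j ≤ i) : φ i ≤ φ j := by
      induction i, hj using Int.leInduction with
      | base => rfl
      | succ i hj ih => exact (hlt i (by omega)).trans (ih (by omega))
    have up (i : ℤ) (hi : (t : ℤ) ≤ i) : φ t ≤ φ i := by
      induction i, hi using Int.leInduction with
      | base => rfl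
      | succ i hi ih => exact ih.trans (hge i hi)
    simp only [excess, ENat.natCast_ne_top, if_false, ENat.toNat_natCast]
    rcases le_total m t with hm | hm
    · have e : (m - (t : ℤ)).toNat = 0 := by omega
      rw [e]
      simpa using down m hm j hj
    · have e : m - ((m - (t : ℤ)).toNat : ℤ) = t := by omega
      rw [e]
      rcases le_total j t with hjt | hjt
      · exact down t le_rfl j hjt
      · exact up j hjt
  · push Not at h
    refine ⟨⊤, fun m j hj => ?_⟩
    simp only [excess, if_true, Nat.cast_zero, sub_zero]
    induction m, hj using Int.leInduction with
    | base => rfl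
    | succ m hj ih =>
      refine le_trans ?_ ih
      rcases lt_or_ge m 0 with h0 | h0
      · exact hanti m h0
      · lift m to ℕ using h0
        exact (h m).le

/-- Thresholds that attain the minimum in the optimality equation. -/
lemma exists_thresholds (hγ1 : γ < 1) (hc : IsAdmissibleCost c) :
    ∃ t : ℤ → ℕ∞, ∀ p q : ℤ,
      postValue μ γ c (limitValue μ γ c) (p - excess (t (p - q)) (min p q))
        (q - excess (t (p - q)) (min p q)) ≤ limitValue μ γ c p q := by
  have hV := diagonalRegular_limitValue (μ := μ) (c := c) hγ1
  -- The diagonal p - q = i is parametrized by j = min p q, so that p = j + i⁺ and q = j + i⁻. Thus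
  -- j < 0 means that one of the differences is negative.
  have key (i : ℤ) := exists_threshold
    (φ := fun j => postValue μ γ c (limitValue μ γ c) (j + i.toNat) (j + (-i).toNat))
    (fun j => hV.postValue_ne_top _ _)
    (fun j => by
      convert hV.postValue_convex (μ := μ) (γ := γ) (c := c) (j + i.toNat) (j + (-i).toNat)
        using 3 <;> ring)
    (fun j hj => by
      have h := hV.postValue_anti (μ := μ) (γ := γ) hc (p := j + i.toNat) (q := j + (-i).toNat)
        (by omega)
      convert h using 2 <;> ring)
  choose t ht using key
  refine ⟨t, fun p q => le_trans (le_iInf fun k => ?_) (bellman_limitValue_le hγ1 hc p q)⟩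
  have h := ht (p - q) (min p q) (min p q - k) (by omega)
  have e1 (k : ℤ) : min p q - k + ((p - q).toNat : ℤ) = p - k := by omega
  have e2 (k : ℤ) : min p q - k + ((-(p - q)).toNat : ℤ) = q - k := by omega
  simpa only [e1, e2] using h

end NMatching

/-! ### Expectations and verification inequalities -/

namespace NMatching

/-- The expectation of `f` under the law of the state at time `n`. -/
noncomputable def expectation (P : PMF State) (f : State → ℝ≥0∞) : ℝ≥0∞ := ∑' y, P y * f y

/-- A decision rule is constrained only on the support of its laws, so comparisons are needed only
there. -/
lemma expectation_mono_support (P : PMF State) {f g : State → ℝ≥0∞}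
    (h : ∀ y ∈ P.support, f y ≤ g y) : expectation P f ≤ expectation P g := by
  refine ENNReal.tsum_le_tsum fun y => ?_
  by_cases hy : y ∈ P.support
  · exact mul_le_mul_right (h y hy) _
  · simp [(P.apply_eq_zero_iff y).2 hy]

lemma expectation_mono (P : PMF State) {f g : State → ℝ≥0∞}
    (h : ∀ y, f y ≤ g y) : expectation P f ≤ expectation P g :=
  expectation_mono_support P fun y _ => h y

lemma expectation_const (P : PMF State) (a : ℝ≥0∞) : expectation P (fun _ => a) = a := by
  rw [expectation, ENNReal.tsum_mul_right, P.tsum_coe, one_mul]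

lemma expectation_add (P : PMF State) (f g : State → ℝ≥0∞) :
    expectation P (fun y => f y + g y) = expectation P f + expectation P g := by
  simp only [expectation, mul_add, ENNReal.tsum_add]

lemma expectation_mul (P : PMF State) (a : ℝ≥0∞) (f : State → ℝ≥0∞) :
    expectation P (fun y => a * f y) = a * expectation P f := by
  simp only [expectation, ← ENNReal.tsum_mul_left, mul_left_comm]

lemma expectation_pure (x : State) (f : State → ℝ≥0∞) : expectation (PMF.pure x) f = f x := by
  rw [expectation, tsum_eq_single x]
  · simp
  · intro y hy
    simp [PMF.pure_apply, hy]

lemma expectation_bind (P : PMF State) (Q : State → PMF State) (f : State → ℝ≥0∞) :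
    expectation (P.bind Q) f = expectation P fun y => expectation (Q y) f := by
  simp only [expectation, PMF.bind_apply, ← ENNReal.tsum_mul_right, ← ENNReal.tsum_mul_left]
  rw [ENNReal.tsum_comm]
  simp only [mul_assoc]

lemma expectation_map (μ : PMF (Fin 4)) (g : Fin 4 → State) (f : State → ℝ≥0∞) :
    expectation (μ.map g) f = ∑ i, μ i * f (g i) := by
  classical
  simp only [expectation, PMF.map_apply, ← ENNReal.tsum_mul_right]
  rw [ENNReal.tsum_comm, tsum_fintype]
  refine Finset.sum_congr rfl fun i _ => ?_
  rw [tsum_eq_single (g i)]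
  · simp
  · intro y hy
    simp [hy]

variable {μ : PMF (Fin 4)} {γ : ℝ≥0} {c : Fin 4 → ℝ≥0}

lemma expectedCost_eq (π : Policy) (x : State) (n : ℕ) :
    expectedCost μ c π x n =
      expectation (stateLaw μ π x n) fun y => (linearCost c y : ℝ≥0∞) := rfl

/-- The expected continuation value after the decision that leaves the state `y`. -/
noncomputable def arrivalMean (μ : PMF (Fin 4)) (f : State → ℝ≥0∞) (y : State) : ℝ≥0∞ :=
  ∑ i, μ i * f (y + item i)

lemma expectation_stateLaw_succ (π : Policy) (x : State) (n : ℕ) (f : State → ℝ≥0∞) :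
    expectation (stateLaw μ π x (n + 1)) f =
      expectation (stateLaw μ π x n) fun y => expectation (π n y) (arrivalMean μ f) := by
  rw [stateLaw, expectation_bind]
  congr 1
  funext y
  rw [expectation_bind]
  congr 1
  funext z
  exact expectation_map μ _ f

/-- Subsolutions of the finite horizon optimality equations bound the cost of all admissible
policies from below. -/
lemma le_discountedCost {G : ℕ → State → ℝ≥0∞} (h0 : ∀ x, G 0 x ≤ linearCost c x)
    (hG : ∀ n x y, (∃ m ∈ matchings x, y + m = x) →
      G (n + 1) x ≤ linearCost c x + γ * arrivalMean μ (G n) y)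
    {π : Policy} (hπ : IsAdmissible π) (x : State) (n : ℕ) :
    G n x ≤ discountedCost μ γ c π x := by
  have step (n k : ℕ) : expectation (stateLaw μ π x k) (G (n + 1)) ≤
      expectedCost μ c π x k + γ * expectation (stateLaw μ π x (k + 1)) (G n) := by
    rw [expectation_stateLaw_succ, expectedCost_eq, ← expectation_mul, ← expectation_add]
    refine expectation_mono _ fun y => ?_
    rw [← expectation_mul, ← expectation_const (π k y) (G (n + 1) y),
      ← expectation_const (π k y) (linearCost c y : ℝ≥0∞), ← expectation_add]
    exact expectation_mono_support _ fun z hz => hG n y z (hπ k y z hz)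
  have main (k : ℕ) : ∀ n, G (n + k) x ≤
      ∑ j ∈ Finset.range k, (γ : ℝ≥0∞) ^ j * expectedCost μ c π x j +
        (γ : ℝ≥0∞) ^ k * expectation (stateLaw μ π x k) (G n) := by
    induction k with
    | zero => simp [stateLaw, expectation_pure]
    | succ k ih =>
      intro n
      rw [← add_assoc, add_right_comm]
      refine (ih (n + 1)).trans ?_
      rw [Finset.sum_range_succ, pow_succ, mul_assoc, add_assoc, ← mul_add]
      gcongr
      exact step n k
  calc G n x ≤ ∑ j ∈ Finset.range n, (γ : ℝ≥0∞) ^ j * expectedCost μ c π x j +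
        (γ : ℝ≥0∞) ^ n * expectation (stateLaw μ π x n) (G 0) := by simpa using main n 0
    -- The terminal value is at most the running cost, so the remainder is absorbed as the term of
    -- index n.
    _ ≤ ∑ j ∈ Finset.range (n + 1), (γ : ℝ≥0∞) ^ j * expectedCost μ c π x j := by
      rw [Finset.sum_range_succ, expectedCost_eq π x n]
      gcongr
      exact expectation_mono _ h0
    _ ≤ _ := ENNReal.sum_le_tsum _

/-- Supersolutions of the evaluation equation of a stationary deterministic policy bound its
cost from above. -/
lemma discountedCost_le {G : State → ℝ≥0∞} {f : State → State}
    (hG : ∀ x, linearCost c x + γ * arrivalMean μ G (f x) ≤ G x) (x : State) :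
    discountedCost μ γ c (fun _ y => PMF.pure (f y)) x ≤ G x := by
  set π : Policy := fun _ y => PMF.pure (f y)
  have main (k : ℕ) : ∑ j ∈ Finset.range k, (γ : ℝ≥0∞) ^ j * expectedCost μ c π x j +
      (γ : ℝ≥0∞) ^ k * expectation (stateLaw μ π x k) G ≤ G x := by
    induction k with
    | zero => simp [stateLaw, expectation_pure]
    | succ k ih =>
      refine le_trans ?_ ih
      rw [Finset.sum_range_succ, pow_succ, mul_assoc, add_assoc, ← mul_add]
      gcongr
      rw [expectation_stateLaw_succ, expectedCost_eq, ← expectation_mul, ← expectation_add]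
      refine expectation_mono _ fun y => ?_
      simpa only [π, expectation_pure] using hG y
  rw [discountedCost, ENNReal.tsum_eq_iSup_nat]
  exact iSup_le fun k => le_self_add.trans (main k)

/-! ### From differences back to states -/

/-- The difference `x 1 - x 0`. -/
def diffFst (x : State) : ℤ := (x 1 : ℤ) - x 0

/-- The difference `x 2 - x 3`. -/
def diffSnd (x : State) : ℤ := (x 2 : ℤ) - x 3

lemma diffFst_add_item (x : State) (i : Fin 4) :
    diffFst (x + item i) = diffFst x + arrivalFst i := by
  fin_cases i <;> simp [diffFst, item, arrivalFst] <;> ring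

lemma diffSnd_add_item (x : State) (i : Fin 4) :
    diffSnd (x + item i) = diffSnd x + arrivalSnd i := by
  fin_cases i <;> simp [diffSnd, item, arrivalSnd] <;> ring

lemma linearCost_add_item (x : State) (i : Fin 4) :
    linearCost c (x + item i) = linearCost c x + c i := by
  simp [linearCost, item, mul_add, Finset.sum_add_distrib, Pi.single_apply]

/-- The value of a state, from a value that depends on the differences only. -/
noncomputable def liftValue (γ : ℝ≥0) (c : Fin 4 → ℝ≥0) (V : ℤ → ℤ → ℝ≥0∞) (x : State) : ℝ≥0∞ :=
  linearCost c x + γ * V (diffFst x) (diffSnd x)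

lemma arrivalMean_liftValue (V : ℤ → ℤ → ℝ≥0∞) (y : State) :
    arrivalMean μ (liftValue γ c V) y = linearCost c y + arrivalCost μ c +
      γ * ∑ i, μ i * V (diffFst y + arrivalFst i) (diffSnd y + arrivalSnd i) := by
  simp only [arrivalMean, liftValue, diffFst_add_item, diffSnd_add_item, linearCost_add_item,
    ENNReal.coe_add, mul_add, Finset.sum_add_distrib, arrivalCost, Finset.mul_sum]
  rw [← Finset.sum_mul, sum_pmf, one_mul]
  simp only [mul_left_comm]

/-- Each class holds at least the positive part of its difference, and costs are nonnegative:
unmatched ℓ₁ and ℓ₃ pairs can only add to the cost. -/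
lemma reducedCost_le_linearCost (c : Fin 4 → ℝ≥0) (y : State) :
    reducedCost c (diffFst y) (diffSnd y) ≤ linearCost c y := by
  unfold reducedCost linearCost diffFst diffSnd
  rw [Fin.sum_univ_four]
  gcongr <;> omega

lemma reducedCost_eq_linearCost {y : State} (h0 : min (y 0) (y 1) = 0)
    (h3 : min (y 2) (y 3) = 0) :
    reducedCost c (diffFst y) (diffSnd y) = linearCost c y := by
  have e0 : (-((y 1 : ℤ) - y 0)).toNat = y 0 := by omega
  have e1 : ((y 1 : ℤ) - y 0).toNat = y 1 := by omega
  have e2 : ((y 2 : ℤ) - y 3).toNat = y 2 := by omega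
  have e3 : (-((y 2 : ℤ) - y 3)).toNat = y 3 := by omega
  rw [reducedCost, linearCost, diffFst, diffSnd, Fin.sum_univ_four, e0, e1, e2, e3]

lemma postValue_le_arrivalMean (V : ℤ → ℤ → ℝ≥0∞) (y : State) :
    postValue μ γ c V (diffFst y) (diffSnd y) ≤ arrivalMean μ (liftValue γ c V) y := by
  rw [arrivalMean_liftValue, postValue]
  gcongr
  exact reducedCost_le_linearCost c y

lemma arrivalMean_eq_postValue (V : ℤ → ℤ → ℝ≥0∞) {y : State} (h0 : min (y 0) (y 1) = 0)
    (h3 : min (y 2) (y 3) = 0) :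
    arrivalMean μ (liftValue γ c V) y = postValue μ γ c V (diffFst y) (diffSnd y) := by
  rw [arrivalMean_liftValue, postValue, reducedCost_eq_linearCost h0 h3]

lemma numMatch_eq_excess (t : ℕ∞) (x : State) :
    numMatch t x = excess t (min (diffFst x) (diffSnd x)) := rfl

lemma numMatch_le (t : ℕ∞) (x : State) :
    numMatch t x ≤ (min (diffFst x) (diffSnd x)).toNat := by
  rw [numMatch_eq_excess]
  unfold excess
  split_ifs <;> omega

lemma thresholdMatch_apply (t : ℤ → ℕ∞) (x : State) :
    thresholdMatch t x 0 = min (x 0) (x 1) ∧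
    thresholdMatch t x 1 = min (x 0) (x 1) + numMatch (t (diffIndex x)) x ∧
    thresholdMatch t x 2 = min (x 2) (x 3) + numMatch (t (diffIndex x)) x ∧
    thresholdMatch t x 3 = min (x 2) (x 3) := by
  simp [thresholdMatch, ell1, ell2, ell3, item]

/-- The truncated subtraction loses nothing: the ℓ₂ matches use at most the items of classes 1 and 2
left over by ℓ₁ and ℓ₃. -/
lemma sub_thresholdMatch_add (t : ℤ → ℕ∞) (x : State) :
    x - thresholdMatch t x + thresholdMatch t x = x := by
  obtain ⟨h0, h1, h2, h3⟩ := thresholdMatch_apply t x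
  have hk := numMatch_le (t (diffIndex x)) x
  simp only [diffFst, diffSnd] at hk
  funext i
  simp only [Pi.add_apply, Pi.sub_apply]
  fin_cases i <;> simp only [Fin.zero_eta, Fin.mk_one, Fin.reduceFinMk, h0, h1, h2, h3] <;> omega

/-- The cost that a threshold rule leaves. -/
lemma arrivalMean_thresholdMatch (V : ℤ → ℤ → ℝ≥0∞) (t : ℤ → ℕ∞) (x : State) :
    arrivalMean μ (liftValue γ c V) (x - thresholdMatch t x) =
      postValue μ γ c V
        (diffFst x - excess (t (diffFst x - diffSnd x)) (min (diffFst x) (diffSnd x)))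
        (diffSnd x - excess (t (diffFst x - diffSnd x)) (min (diffFst x) (diffSnd x))) := by
  obtain ⟨h0, h1, h2, h3⟩ := thresholdMatch_apply t x
  have hk := numMatch_le (t (diffIndex x)) x
  have hd : diffIndex x = diffFst x - diffSnd x := rfl
  rw [← hd, ← numMatch_eq_excess]
  simp only [diffFst, diffSnd] at hk ⊢
  rw [arrivalMean_eq_postValue]
  · simp only [diffFst, diffSnd, Pi.sub_apply, h0, h1, h2, h3]
    congr 1 <;> omega
  · simp only [Pi.sub_apply, h0, h1]; omega
  · simp only [Pi.sub_apply, h2, h3]; omega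

end NMatching

/-! ### Matchings of the block model graph -/

namespace NMatching

lemma nGraph_adj (i j : Fin 4) : nGraph.Adj i j ↔
    (i = 0 ∧ j = 1) ∨ (i = 1 ∧ j = 0) ∨ (i = 1 ∧ j = 2) ∨ (i = 2 ∧ j = 1) ∨
      (i = 2 ∧ j = 3) ∨ (i = 3 ∧ j = 2) := by
  simp only [nGraph, SimpleGraph.fromEdgeSet_adj, Set.mem_insert_iff, Set.mem_singleton_iff]
  decide +revert

variable {x : State}

/-- The number of edges from class `i` to class `j` in a matching. -/
noncomputable def edgeCount (M : (blockGraph x).Subgraph) (i j : Fin 4) : ℕ :=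
  {v | v.1 = i ∧ ∃ w, M.Adj v w ∧ w.1 = j}.ncard

/-- Sending a node to its partner is injective, and exchanges the roles of the two classes. -/
lemma edgeCount_comm {M : (blockGraph x).Subgraph} (hM : M.IsMatching) (i j : Fin 4) :
    edgeCount M i j = edgeCount M j i := by
  have key (i j : Fin 4) : edgeCount M i j ≤ edgeCount M j i := by
    have h : ∀ v ∈ {v | v.1 = i ∧ ∃ w, M.Adj v w ∧ w.1 = j}, ∃ w, M.Adj v w ∧ w.1 = j :=
      fun v hv => hv.2
    choose! f hf using h
    refine Set.ncard_le_ncard_of_injOn f (fun v hv => ⟨(hf v hv).2, v, (hf v hv).1.symm, hv.1⟩)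
      (fun v hv w hw hvw => ?_) (Set.toFinite _)
    have h1 := (hf v hv).1
    have h2 := (hf w hw).1
    rw [← hvw] at h2
    exact hM.eq_of_adj_right h1 h2
  exact (key i j).antisymm (key j i)

/-- Every matched node has exactly one partner, so the matched nodes of a class are partitioned by
the class of the partner. -/
lemma ncard_verts_eq_sum {M : (blockGraph x).Subgraph} (hM : M.IsMatching) (i : Fin 4) :
    {v ∈ M.verts | v.1 = i}.ncard = ∑ j, edgeCount M i j := by
  classical
  have h : {v ∈ M.verts | v.1 = i} = ⋃ j, {v | v.1 = i ∧ ∃ w, M.Adj v w ∧ w.1 = j} := by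
    ext v
    simp only [Set.mem_ofPred_eq, Set.mem_iUnion]
    constructor
    · rintro ⟨hv, hi⟩
      obtain ⟨w, hw, -⟩ := hM hv
      exact ⟨w.1, hi, w, hw, rfl⟩
    · rintro ⟨j, hi, w, hw, -⟩
      exact ⟨M.edge_vert hw, hi⟩
  rw [h, Set.ncard_iUnion_of_finite (fun _ => Set.toFinite _), finsum_eq_sum_of_fintype]
  · rfl
  · intro j k hjk
    refine Set.disjoint_left.2 ?_
    rintro v ⟨-, w, hw, hwj⟩ ⟨-, w', hw', hwk⟩
    rw [hM.eq_of_adj_left hw hw'] at hwj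
    exact hjk (hwj.symm.trans hwk)

lemma edgeCount_eq_zero (M : (blockGraph x).Subgraph) {i j : Fin 4} (h : ¬ nGraph.Adj i j) :
    edgeCount M i j = 0 := by
  rw [edgeCount, Set.ncard_eq_zero]
  refine Set.eq_empty_iff_forall_notMem.2 ?_
  rintro v ⟨rfl, w, hw, rfl⟩
  exact h hw.adj_sub

/-- The `ℓ₂` edges are the only ones that change the differences. -/
lemma exists_of_mem_matchings {m : State} (hm : m ∈ matchings x) :
    ∃ k, m 1 = m 0 + k ∧ m 2 = m 3 + k := by
  obtain ⟨M, hM, h⟩ := hm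
  simp only [ncard_verts_eq_sum hM, Fin.sum_univ_four] at h
  have z (i j : Fin 4) (hij : ¬ nGraph.Adj i j) := edgeCount_eq_zero M hij
  simp only [nGraph_adj] at z
  refine ⟨edgeCount M 1 2, ?_, ?_⟩
  · rw [h, h, z 0 0 (by decide), z 0 2 (by decide), z 0 3 (by decide), z 1 1 (by decide),
      z 1 3 (by decide), edgeCount_comm hM 0 1]
    ring
  · rw [h, h, z 2 0 (by decide), z 2 2 (by decide), z 3 0 (by decide), z 3 1 (by decide),
      z 3 3 (by decide), edgeCount_comm hM 2 1, edgeCount_comm hM 3 2]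
    ring

/-- The directed pairs of a matching with `a`, `k` and `b` edges `ℓ₁`, `ℓ₂` and `ℓ₃`: the nodes
of each class are numbered, and those of the classes `1` and `2` are first used in the edges `ℓ₁`
and `ℓ₃`. -/
def IsPair (a k b : ℕ) (i : Fin 4) (s : ℕ) (j : Fin 4) (t : ℕ) : Prop :=
  (i = 0 ∧ j = 1 ∧ s = t ∧ s < a) ∨
  (i = 1 ∧ j = 2 ∧ s + b = t + a ∧ a ≤ s ∧ s < a + k) ∨
  (i = 2 ∧ j = 3 ∧ s = t ∧ s < b)

/-- A matching with `a`, `k` and `b` edges `ℓ₁`, `ℓ₂` and `ℓ₃`. -/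
def pairSubgraph (x : State) (a k b : ℕ) : (blockGraph x).Subgraph where
  verts := {v | (v.2 : ℕ) < ![a, a + k, b + k, b] v.1}
  Adj v w := IsPair a k b v.1 v.2 w.1 w.2 ∨ IsPair a k b w.1 w.2 v.1 v.2
  adj_sub {v w} h := by
    change nGraph.Adj v.1 w.1
    rw [nGraph_adj]
    unfold IsPair at h
    tauto
  edge_vert {v w} h := by
    obtain ⟨i, s⟩ := v
    obtain ⟨j, t⟩ := w
    simp only [Set.mem_ofPred_eq]
    rcases h with (⟨rfl, rfl, h⟩ | ⟨rfl, rfl, h⟩ | ⟨rfl, rfl, h⟩) |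
      (⟨rfl, rfl, h⟩ | ⟨rfl, rfl, h⟩ | ⟨rfl, rfl, h⟩) <;> simp at h ⊢ <;> omega
  symm := ⟨fun _ _ => Or.symm⟩

lemma pairSubgraph_adj {a k b : ℕ} {i j : Fin 4} {s : Fin (x i)} {t : Fin (x j)} :
    (pairSubgraph x a k b).Adj ⟨i, s⟩ ⟨j, t⟩ ↔ IsPair a k b i s j t ∨ IsPair a k b j t i s :=
  Iff.rfl

lemma mem_verts_pairSubgraph {a k b : ℕ} {v : Σ i : Fin 4, Fin (x i)} :
    v ∈ (pairSubgraph x a k b).verts ↔ (v.2 : ℕ) < ![a, a + k, b + k, b] v.1 :=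
  Iff.rfl

lemma isMatching_pairSubgraph {a k b : ℕ} (h0 : a ≤ x 0) (h1 : a + k ≤ x 1) (h2 : b + k ≤ x 2)
    (h3 : b ≤ x 3) : (pairSubgraph x a k b).IsMatching := by
  intro v hv
  have uniq (w w' : Σ i : Fin 4, Fin (x i)) (hw : (pairSubgraph x a k b).Adj v w)
      (hw' : (pairSubgraph x a k b).Adj v w') : w = w' := by
    obtain ⟨i, s, hs⟩ := v
    obtain ⟨j, t, ht⟩ := w
    obtain ⟨j', t', ht'⟩ := w'
    rw [pairSubgraph_adj] at hw hw'
    unfold IsPair at hw hw'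
    have hj : j = j' := by grind
    subst hj
    have ht : t = t' := by grind
    subst ht
    rfl
  suffices h : ∃ w, (pairSubgraph x a k b).Adj v w by
    obtain ⟨w, hw⟩ := h
    exact ⟨w, hw, fun w' hw' => uniq w' w hw' hw⟩
  obtain ⟨i, s, hs⟩ := v
  rw [mem_verts_pairSubgraph] at hv
  fin_cases i <;> simp at hv hs
  · exact ⟨⟨1, s, by omega⟩, pairSubgraph_adj.2 (Or.inl (Or.inl ⟨rfl, rfl, rfl, hv⟩))⟩
  · rcases lt_or_ge s a with h | h
    · exact ⟨⟨0, s, by omega⟩, pairSubgraph_adj.2 (Or.inr (Or.inl ⟨rfl, rfl, rfl, h⟩))⟩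
    -- The nodes in ℓ₂ edges are numbered from a in class 1 and from b in class 2, whence the shift
    -- by b - a.
    · exact ⟨⟨2, s + b - a, by omega⟩, pairSubgraph_adj.2
        (Or.inl (Or.inr (Or.inl ⟨rfl, rfl, by simp only; omega, h, hv⟩)))⟩
  · rcases lt_or_ge s b with h | h
    · exact ⟨⟨3, s, by omega⟩, pairSubgraph_adj.2 (Or.inl (Or.inr (Or.inr ⟨rfl, rfl, rfl, h⟩)))⟩
    · exact ⟨⟨1, s + a - b, by omega⟩, pairSubgraph_adj.2
        (Or.inr (Or.inr (Or.inl ⟨rfl, rfl, by simp only; omega, by simp only; omega,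
          by simp only; omega⟩)))⟩
  · exact ⟨⟨2, s, by omega⟩, pairSubgraph_adj.2 (Or.inr (Or.inr (Or.inr ⟨rfl, rfl, rfl, hv⟩)))⟩

lemma ncard_class_lt (i : Fin 4) (n : Fin 4 → ℕ) (h : n i ≤ x i) :
    {v ∈ {v : Σ i : Fin 4, Fin (x i) | (v.2 : ℕ) < n v.1} | v.1 = i}.ncard = n i := by
  have e : {v ∈ {v : Σ i : Fin 4, Fin (x i) | (v.2 : ℕ) < n v.1} | v.1 = i} =
      Set.range fun s : Fin (n i) => (⟨i, s.castLE h⟩ : Σ i : Fin 4, Fin (x i)) := by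
    ext v
    simp only [Set.mem_ofPred_eq, Set.mem_range]
    constructor
    · rintro ⟨hv, rfl⟩
      exact ⟨⟨v.2, hv⟩, rfl⟩
    · rintro ⟨s, rfl⟩
      exact ⟨s.2, rfl⟩
  rw [e, ← Nat.card_coe_set_eq, Nat.card_range_of_injective, Nat.card_eq_fintype_card,
    Fintype.card_fin]
  intro s t hst
  simpa using hst

lemma mem_matchings {m : State} {a k b : ℕ} (h0 : a ≤ x 0) (h1 : a + k ≤ x 1) (h2 : b + k ≤ x 2)
    (h3 : b ≤ x 3) (hm : m = ![a, a + k, b + k, b]) : m ∈ matchings x := by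
  refine ⟨pairSubgraph x a k b, isMatching_pairSubgraph h0 h1 h2 h3, fun i => ?_⟩
  subst hm
  exact (ncard_class_lt i ![a, a + k, b + k, b] (by fin_cases i <;> assumption)).symm

end NMatching

/-! ### Optimality of the threshold rule -/

namespace NMatching

variable {μ : PMF (Fin 4)} {γ : ℝ≥0} {c : Fin 4 → ℝ≥0}

lemma isDecisionRule_threshold (t : ℤ → ℕ∞) :
    IsDecisionRule fun x => PMF.pure (x - thresholdMatch t x) := by
  intro x y hy
  rw [PMF.support_pure, Set.mem_singleton_iff] at hy
  subst hy
  refine ⟨_, ?_, sub_thresholdMatch_add t x⟩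
  obtain ⟨h0, h1, h2, h3⟩ := thresholdMatch_apply t x
  have hk := numMatch_le (t (diffIndex x)) x
  simp only [diffFst, diffSnd] at hk
  refine mem_matchings (a := min (x 0) (x 1)) (k := numMatch (t (diffIndex x)) x)
    (b := min (x 2) (x 3)) (by omega) (by omega) (by omega) (by omega) ?_
  funext i
  fin_cases i
  exacts [h0, h1, h2, h3]

/-- The finite horizon optimality inequality, over all the matchings of a state. -/
lemma liftValue_valueIter_succ_le (n : ℕ) {x y m : State} (hm : m ∈ matchings x) (hy : y + m = x) :
    liftValue γ c (valueIter μ γ c (n + 1)) x ≤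
      linearCost c x + γ * arrivalMean μ (liftValue γ c (valueIter μ γ c n)) y := by
  obtain ⟨k, h1, h2⟩ := exists_of_mem_matchings hm
  have e1 : diffFst x - k = diffFst y := by
    simp only [← hy, diffFst, Pi.add_apply]; omega
  have e2 : diffSnd x - k = diffSnd y := by
    simp only [← hy, diffSnd, Pi.add_apply]; omega
  -- The number k of ℓ₂ edges in the matching is one of the choices in the relaxed infimum, which
  -- checks no feasibility.
  refine add_le_add le_rfl (mul_le_mul_right ((iInf_le _ k).trans ?_) _)
  rw [e1, e2]
  exact postValue_le_arrivalMean _ y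

/-- The lower bound holds for every finite horizon, starting from the running cost at horizon 0, and
passes to the supremum. -/
lemma liftValue_limitValue_le_discountedCost {π : Policy} (hπ : IsAdmissible π) (x : State) :
    liftValue γ c (limitValue μ γ c) x ≤ discountedCost μ γ c π x := by
  have h (n : ℕ) := le_discountedCost (μ := μ) (γ := γ) (c := c)
    (G := fun n => liftValue γ c (valueIter μ γ c n)) (fun x => by simp [liftValue, valueIter])
    (fun n x y ⟨m, hm, hy⟩ => liftValue_valueIter_succ_le n hm hy) hπ x n
  unfold liftValue limitValue at *
  rw [ENNReal.mul_iSup, ENNReal.add_iSup]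
  exact iSup_le h

end NMatching

theorem theorem1 (μ : PMF (Fin 4)) (γ : ℝ≥0) (hγ0 : 0 < γ) (hγ1 : γ < 1)
    (c : Fin 4 → ℝ≥0) (hc : NMatching.IsAdmissibleCost c) :
    ∃ u : NMatching.Rule, NMatching.IsThresholdRule u ∧
      NMatching.IsOptimal μ γ c (fun _ => u) := by
  obtain ⟨t, ht⟩ := NMatching.exists_thresholds (μ := μ) hγ1 hc
  refine ⟨fun x => PMF.pure (x - NMatching.thresholdMatch t x), ⟨t, fun _ => rfl⟩,
    fun _ => NMatching.isDecisionRule_threshold t, fun π hπ x => le_trans ?_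
      (NMatching.liftValue_limitValue_le_discountedCost hπ x)⟩
  refine NMatching.discountedCost_le (fun y => ?_) x
  rw [NMatching.arrivalMean_thresholdMatch]
  exact add_le_add le_rfl (mul_le_mul_right (ht _ _) _)
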